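/- By a zero-dimensional system we mean a pair $(X,f)$ of a compact metrizable space $X$ that has a basis of clopen sets and a homeomorphism $f:X\to X$. It has finite rank if it is topologically conjugate to a Bratteli--Vershik system $(E_{0,\infty},\phi)$ of an ordered Bratteli diagram with vertex levels $V_0,V_1,V_2,\dots$ and $\liminf_{n\to\infty}\#V_n<\infty$. Here $V_0$ is a single vertex; the vertex levels $V_n$ and the sets $E_n$ ($n\ge1$) of edges from $V_{n-1}$ to $V_n$ are finite and non-empty; every vertex is the source of some edge, and every vertex outside $V_0$ is the range of some edge; two edges are comparable if and only if they have the same range; $E_{0,\infty}\subseteq\prod_{n\ge1}E_n$ is the space of infinite paths starting in $V_0$, with the topology induced by the product of the discrete topologies; and $\phi$ is a homeomorphism of $E_{0,\infty}$ that maps the set of maximal paths bijectively onto the set of minimal paths and sends every non-maximal path to its successor: the first non-maximal edge is replaced by its successor, the edges before it by the minimal path from $V_0$ to the source of that successor, and the later edges are kept. The system $(X,f)$ is proximal if $\liminf_{n\to+\infty}d(f^n x,f^n y)=0$ for all $x,y\in X$, where $d$ is a metric compatible with the topology of $X$. **Corollary.** Every finite-rank proximal zero-dimensional system $(X,f)$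 is symbolic, i.e. topologically conjugate to a two-sided subshift: a closed shift-invariant subset of $A^{\mathbb Z}$, for some finite alphabet $A$, with the shift map. -/

import Mathlib

open Filter Topology

/-- An ordered Bratteli diagram. `V n` is the set of vertices of level `n`, and `E n` is the set of
edges going from level `n` to level `n + 1` (so `E n` is usually written `E_{n+1}`). -/
structure OrderedBratteliDiagram where
  /-- vertices of level `n` -/
  V : ℕ → Type
  /-- edges from level `n` to level `n + 1` -/
  E : ℕ → Type
  finite_V : ∀ n, Finite (V n)
  finite_E : ∀ n, Finite (E n)
  nonempty_V : ∀ n, Nonempty (V n)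
  nonempty_E : ∀ n, Nonempty (E n)
  /-- the top level consists of a single vertex -/
  subsingleton_V_zero : Subsingleton (V 0)
  /-- source map -/
  s : ∀ n, E n → V n
  /-- range map -/
  r : ∀ n, E n → V (n + 1)
  s_surjective : ∀ n, Function.Surjective (s n)
  r_surjective : ∀ n, Function.Surjective (r n)
  /-- the partial order on edges -/
  order : ∀ n, PartialOrder (E n)
  /-- two edges are comparable if and only if they have the same range -/
  comparable_iff : ∀ n (e e' : E n), (e ≤ e' ∨ e' ≤ e) ↔ r n e = r n e'

namespace OrderedBratteliDiagram

instance (B : OrderedBratteliDiagram) (n : ℕ) : PartialOrder (B.E n) := B.order n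

/-- Each (finite) edge set carries the discrete topology. -/
instance (B : OrderedBratteliDiagram) (n : ℕ) : TopologicalSpace (B.E n) := ⊥

instance (B : OrderedBratteliDiagram) (n : ℕ) : DiscreteTopology (B.E n) := ⟨rfl⟩

/-- The space of infinite paths from the top vertex, with the topology induced by the product
topology on `∀ n, B.E n`. -/
abbrev InfinitePath (B : OrderedBratteliDiagram) : Type :=
  {e : ∀ n, B.E n // ∀ n, B.r n (e n) = B.s (n + 1) (e (n + 1))}

/-- The set of maximal infinite paths: every edge is maximal in `r⁻¹` of its range.
(Only edges with the same range are comparable, so this is `IsMax` for the edge order.) -/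
def maxPaths (B : OrderedBratteliDiagram) : Set B.InfinitePath :=
  {e | ∀ n, IsMax (e.1 n)}

/-- The set of minimal infinite paths. -/
def minPaths (B : OrderedBratteliDiagram) : Set B.InfinitePath :=
  {e | ∀ n, IsMin (e.1 n)}

/-- A homeomorphism `φ` of the path space is a Vershik map if it maps the maximal paths
bijectively onto the minimal ones, and sends a non-maximal path `e`, whose first
non-maximal edge is `e n`, to the path that has the successor of `e n` at place `n`, only minimal
edges before it, and the same edges as `e` after it. -/
structure IsVershikMap (B : OrderedBratteliDiagram) (φ : B.InfinitePath ≃ₜ B.InfinitePath) :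
    Prop where
  bijOn : Set.BijOn φ B.maxPaths B.minPaths
  successor : ∀ (e : B.InfinitePath) (n : ℕ), (∀ k < n, IsMax (e.1 k)) → ¬ IsMax (e.1 n) →
    IsLeast (Set.Ioi (e.1 n)) ((φ e).1 n) ∧
    (∀ k < n, IsMin ((φ e).1 k)) ∧
    (∀ k, n < k → (φ e).1 k = e.1 k)

/-- The rank of a Bratteli diagram: `liminf` of the numbers of vertices, a value in `ℕ∞`. -/
noncomputable def rank (B : OrderedBratteliDiagram) : ℕ∞ :=
  liminf (fun n => (Nat.card (B.V n) : ℕ∞)) atTop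

/-- `B` with the Vershik map `φ` represents the system `(X, f)`: the two are topologically
conjugate. -/
def Represents (B : OrderedBratteliDiagram) {X : Type*} [TopologicalSpace X] (f : X ≃ₜ X) : Prop :=
  ∃ φ : B.InfinitePath ≃ₜ B.InfinitePath, B.IsVershikMap φ ∧
    ∃ h : X ≃ₜ B.InfinitePath, Function.Semiconj h f φ

end OrderedBratteliDiagram

/-- The topological rank of a system: the minimum of the ranks of the ordered Bratteli diagrams
representing it (`⊤` if every such rank is infinite). -/
noncomputable def topologicalRank {X : Type*} [TopologicalSpace X] (f : X ≃ₜ X) : ℕ∞ :=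
  sInf {K : ℕ∞ | ∃ B : OrderedBratteliDiagram, B.Represents f ∧ B.rank = K}

/-- Finite-rank systems. -/
def HasFiniteRank {X : Type*} [TopologicalSpace X] (f : X ≃ₜ X) : Prop :=
  topologicalRank f < ⊤

/-- A system is proximal if `liminf_{n → +∞} d(fⁿ x, fⁿ y) = 0` for every pair `x, y`. -/
def IsProximalSystem {X : Type*} [MetricSpace X] (f : X ≃ₜ X) : Prop :=
  ∀ x y : X, ∀ ε > 0, ∃ᶠ n : ℕ in atTop, dist (f^[n] x) (f^[n] y) < ε

/-- A system is symbolic if it is topologically conjugate to a two-sided subshift, i.e. a closed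
shift-invariant subset of `A^ℤ` with a finite discrete alphabet `A = Fin k`, with the
left shift `(σ x) i = x (1 + i)`. -/
def IsSymbolic {X : Type*} [TopologicalSpace X] (f : X ≃ₜ X) : Prop :=
  ∃ (k : ℕ) (Y : SymbolicDynamics.FullShift.Subshift (Fin k) ℤ) (h : X ≃ₜ Y.carrier),
    ∀ x : X, (h (f x) : ℤ → Fin k) = SymbolicDynamics.FullShift.shift 1 (h x : ℤ → Fin k)

/-! ### Combinatorics of words: the defect theorem, iterated. -/

section FreeMonoid

/-! It suffices that for some `n` the first `n` edges, read along the whole orbit, determine the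
point; the itinerary map is then the conjugacy. Otherwise there are levels `N 0 < N 1 < ...` and,
for each `i`, a pair of orbits that always agree to depth `N i` but not to depth `N (i + 1)`. Choose
a deep level `m` with at most `K` vertices. Proximality and compactness make the pair agree to depth
`m` both before and after the disagreement, and such agreement forces a later simultaneous visit to
tower bottoms. Between two such visits both itineraries are products of at most `K` words, giving a
relation that holds at depth `N i` and fails at depth `N (i + 1)`. By the defect theorem each
relation, used from the finest to the coarsest, costs at least one word; `K + 1` relations are too
many (`not_forall_relation_of_card_le`). -/

theorem exists_cons_ne_of_flatMap_eq {A B : Type*} {w : A → List B} (hw : ∀ a, w a ≠ []) :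
    ∀ {l₁ l₂ : List A}, l₁.flatMap w = l₂.flatMap w → l₁ ≠ l₂ →
      ∃ a b t₁ t₂, a ≠ b ∧ (a :: t₁).flatMap w = (b :: t₂).flatMap w := by
  intro l₁
  induction l₁ with
  | nil =>
    intro l₂ h hne
    cases l₂ with
    | nil => exact absurd rfl hne
    | cons b t => simp [hw] at h
  | cons a t₁ ih =>
    intro l₂ h hne
    cases l₂ with
    | nil => simp [hw] at h
    | cons b t₂ =>
      by_cases hab : a = b
      · subst hab
        exact ih (by simpa using h) (by simpa using hne)
      · exact ⟨a, b, t₁, t₂, hab, h⟩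

theorem head?_flatMap_elementary_ne {A : Type*} [DecidableEq A] {a b : A} (hab : a ≠ b)
    (l : List A) : (l.flatMap fun c => if c = b then [a, b] else [c]).head? ≠ some b := by
  cases l with
  | nil => simp
  | cons c t =>
    by_cases hc : c = b
    · simp [hc, hab]
    · simp [hc]

/-- The defect theorem: a non-trivial relation between words allows them to be written as products
of strictly fewer words. -/
theorem exists_flatMap_factorization {A : Type} {B : Type*} [Finite A] {w : A → List B}
    (hw : ∀ a, w a ≠ []) {l₁ l₂ : List A} (h : l₁.flatMap w = l₂.flatMap w) (hne : l₁ ≠ l₂) :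
    ∃ (A' : Type) (_ : Finite A') (p : A → List A') (w' : A' → List B),
      Nat.card A' < Nat.card A ∧ (∀ a, w' a ≠ []) ∧ ∀ a, w a = (p a).flatMap w' := by
  classical
  have := Fintype.ofFinite A
  induction hN : ∑ a, (w a).length using Nat.strong_induction_on generalizing w l₁ l₂ with
  | _ N ih =>
  subst hN
  obtain ⟨a, b, t₁, t₂, hab, heq⟩ := exists_cons_ne_of_flatMap_eq hw h hne
  clear h hne l₁ l₂
  wlog hle : (w a).length ≤ (w b).length generalizing a b t₁ t₂
  · exact this b a t₂ t₁ hab.symm heq.symm (le_of_not_ge hle)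
  have hpre : w a <+: w b := by
    refine List.prefix_of_prefix_length_le (l₃ := (b :: t₂).flatMap w) ?_ ?_ hle
    · rw [← heq]; simp
    · simp
  obtain ⟨u, hu⟩ := hpre
  by_cases hnil : u = []
  · subst hnil
    refine ⟨{c : A // c ≠ b}, inferInstance, fun c => if hc : c = b then [⟨a, hab⟩] else [⟨c, hc⟩],
      fun c => w c, ?_, fun c => hw c, fun c => ?_⟩
    · rw [Nat.card_eq_fintype_card, Nat.card_eq_fintype_card]
      exact Fintype.card_subtype_lt (x := b) (by simp)
    · by_cases hc : c = b
      · subst hc; simpa using hu.symm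
      · simp [hc]
  -- Replacing `w b = w a ++ u` by `u` shortens the total length; the substitution `b ↦ ab` recovers
  -- the old words.
  · let e : A → List A := fun c => if c = b then [a, b] else [c]
    let w₁ : A → List B := Function.update w b u
    have hw₁ : ∀ c, w₁ c ≠ [] := by
      intro c
      by_cases hc : c = b
      · subst hc; simpa [w₁] using hnil
      · simpa [w₁, hc] using hw c
    have hfac : ∀ c, w c = (e c).flatMap w₁ := by
      intro c
      by_cases hc : c = b
      · subst hc; simp [e, w₁, hab, hu]
      · simp [e, w₁, hc]
    have hfac' : ∀ l : List A, l.flatMap w = (l.flatMap e).flatMap w₁ := by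
      intro l
      rw [List.flatMap_assoc]
      exact congrArg (fun g => l.flatMap g) (funext hfac)
    have hlt : ∑ c, (w₁ c).length < ∑ c, (w c).length := by
      refine Finset.sum_lt_sum (fun c _ => ?_) ⟨b, Finset.mem_univ b, ?_⟩
      · by_cases hc : c = b
        · subst hc; simp [w₁, ← hu]
        · simp [w₁, hc]
      · simpa [w₁, ← hu, List.length_pos_iff] using hw a
    obtain ⟨A', hA', p, w', hcard, hw', hp⟩ := ih _ hlt hw₁
      (l₁ := (a :: t₁).flatMap e) (l₂ := (b :: t₂).flatMap e)
      (by rw [← hfac', ← hfac', heq])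
      -- The relation stays non-trivial: after cancelling `a`, equality would make an image under
      -- `e` begin with `b`.
      (by
        intro hh
        have h1 : t₁.flatMap e = b :: t₂.flatMap e := by simpa [e, hab] using hh
        exact head?_flatMap_elementary_ne hab t₁ (by
          change (t₁.flatMap e).head? = _
          rw [h1]; rfl)) rfl
    refine ⟨A', hA', fun c => (e c).flatMap p, w', hcard, hw', fun c => ?_⟩
    rw [hfac c, List.flatMap_assoc]
    exact congrArg (fun g => (e c).flatMap g) (funext hp)

/-- Words on at most `K` letters do not satisfy more than `K` successive relations, each of which is
preserved by a letter projection but not by the next finer one. -/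
theorem not_forall_relation_of_card_le {B : Type*} {q : ℕ → B → B}
    (hq : ∀ i j, i ≤ j → ∀ b, q i (q j b) = q i b) (K : ℕ) {A : Type} [Finite A]
    (hA : Nat.card A ≤ K) {w : A → List B} (hw : ∀ a, w a ≠ []) :
    ¬ ∀ i ≤ K, ∃ l₁ l₂ : List A,
      (l₁.flatMap w).map (q i) = (l₂.flatMap w).map (q i) ∧
      (l₁.flatMap w).map (q (i + 1)) ≠ (l₂.flatMap w).map (q (i + 1)) := by
  intro H
  induction K generalizing A with
  | zero =>
    have : IsEmpty A := by
      rcases (Nat.card_eq_zero (α := A)).1 (by omega) with h | h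
      · exact h
      · exact absurd ‹Finite A› (not_finite_iff_infinite.2 h)
    obtain ⟨l₁, l₂, -, h⟩ := H 0 le_rfl
    exact h (by rw [Subsingleton.elim l₁ l₂])
  | succ K ih =>
    -- The finest relation goes first: the fewer words obtained at its depth still determine every
    -- coarser projection.
    obtain ⟨l₁, l₂, h, hne⟩ := H (K + 1) le_rfl
    have hmap : ∀ l : List A, (l.flatMap w).map (q (K + 1)) =
        l.flatMap fun a => (w a).map (q (K + 1)) := fun l => by rw [List.map_flatMap]
    rw [hmap, hmap] at h
    obtain ⟨A', hA', p, w', hcard, hw', hp⟩ := exists_flatMap_factorization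
      (by simpa using hw) h (by rintro rfl; exact hne rfl)
    have hfac : ∀ i ≤ K + 1, ∀ l : List A,
        (l.flatMap w).map (q i) = ((l.flatMap p).flatMap w').map (q i) := by
      intro i hi l
      have h1 : (l.flatMap p).flatMap w' = (l.flatMap w).map (q (K + 1)) := by
        rw [hmap, List.flatMap_assoc]
        exact congrArg (fun g => l.flatMap g) (funext fun a => (hp a).symm)
      rw [h1, List.map_map]
      exact List.map_congr_left fun b _ => (hq i (K + 1) hi b).symm
    refine ih (by omega) hw' fun i hi => ?_
    obtain ⟨l₁, l₂, h, hne⟩ := H i (by omega)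
    refine ⟨l₁.flatMap p, l₂.flatMap p, ?_, ?_⟩
    · rwa [← hfac i (by omega), ← hfac i (by omega)]
    · rwa [← hfac (i + 1) (by omega), ← hfac (i + 1) (by omega)]

end FreeMonoid

/-! ### Towers of an ordered diagram and the Vershik map. -/

namespace OrderedBratteliDiagram

variable {B : OrderedBratteliDiagram}

/-- Two paths have the same first `m` edges. -/
def Agree (m : ℕ) (x y : B.InfinitePath) : Prop := ∀ k < m, x.1 k = y.1 k

/-- The first `m` edges of `x` are minimal. -/
def MinUpTo (m : ℕ) (x : B.InfinitePath) : Prop := ∀ k < m, IsMin (x.1 k)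

/-- The first `m` edges of `x` are maximal. -/
def MaxUpTo (m : ℕ) (x : B.InfinitePath) : Prop := ∀ k < m, IsMax (x.1 k)

/-- The vertex of level `m` on the path `x`. -/
def vertex (m : ℕ) (x : B.InfinitePath) : B.V m := B.s m (x.1 m)

/-- The first `m` edges of `x`, padded to an infinite sequence. -/
def code (m : ℕ) (x : B.InfinitePath) : ∀ k, Option (B.E k) :=
  fun k => if k < m then some (x.1 k) else none

/-- Truncation of a padded sequence. -/
def truncate (n : ℕ) (z : ∀ k, Option (B.E k)) : ∀ k, Option (B.E k) :=
  fun k => if k < n then z k else none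

theorem code_eq_iff {m : ℕ} {x y : B.InfinitePath} : code m x = code m y ↔ Agree m x y := by
  constructor
  · intro h k hk
    have := congrFun h k
    simpa [code, hk] using this
  · intro h
    funext k
    by_cases hk : k < m
    · simp [code, hk, h k hk]
    · simp [code, hk]

theorem truncate_code {n m : ℕ} (h : n ≤ m) (x : B.InfinitePath) :
    truncate n (code m x) = code n x := by
  funext k
  by_cases hk : k < n
  · simp [truncate, code, hk, hk.trans_le h]
  · simp [truncate, code, hk]

theorem truncate_truncate {n m : ℕ} (h : n ≤ m) (z : ∀ k, Option (B.E k)) :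
    truncate n (truncate m z) = truncate n z := by
  funext k
  by_cases hk : k < n
  · simp [truncate, hk, hk.trans_le h]
  · simp [truncate, hk]

theorem Agree.symm {m : ℕ} {x y : B.InfinitePath} (h : Agree m x y) : Agree m y x :=
  fun k hk => (h k hk).symm

theorem Agree.mono {n m : ℕ} (hnm : n ≤ m) {x y : B.InfinitePath} (h : Agree m x y) :
    Agree n x y := fun k hk => h k (hk.trans_le hnm)

theorem Agree.minUpTo {m : ℕ} {x y : B.InfinitePath} (h : Agree m x y) (hx : MinUpTo m x) :
    MinUpTo m y := fun k hk => h k hk ▸ hx k hk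

theorem Agree.maxUpTo {m : ℕ} {x y : B.InfinitePath} (h : Agree m x y) (hx : MaxUpTo m x) :
    MaxUpTo m y := fun k hk => h k hk ▸ hx k hk

theorem edge_eq_of_isMin {n : ℕ} {e e' : B.E n} (h : IsMin e) (h' : IsMin e')
    (hr : B.r n e = B.r n e') : e = e' := by
  rcases (B.comparable_iff n e e').2 hr with hle | hle
  · exact le_antisymm hle (h' hle)
  · exact le_antisymm (h hle) hle

/-- The minimal path to a given vertex is unique. -/
theorem agree_of_minUpTo {m : ℕ} {x y : B.InfinitePath} (hx : MinUpTo m x) (hy : MinUpTo m y)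
    (h : vertex m x = vertex m y) : Agree m x y := by
  induction m with
  | zero => intro k hk; omega
  | succ m ih =>
    have hm : x.1 m = y.1 m := edge_eq_of_isMin (hx m m.lt_succ_self) (hy m m.lt_succ_self)
      (by rw [x.2, y.2]; exact h)
    have := ih (fun k hk => hx k (by omega)) (fun k hk => hy k (by omega))
      (by unfold vertex; rw [hm])
    intro k hk
    rcases Nat.lt_succ_iff_lt_or_eq.1 hk with hk | rfl
    · exact this k hk
    · exact hm

theorem exists_first_not_isMax {m : ℕ} {x : B.InfinitePath} (h : ¬ MaxUpTo m x) :
    ∃ n < m, (∀ k < n, IsMax (x.1 k)) ∧ ¬ IsMax (x.1 n) := by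
  classical
  have h' : ∃ n, n < m ∧ ¬ IsMax (x.1 n) := by
    unfold MaxUpTo at h
    push Not at h
    exact h
  refine ⟨Nat.find h', (Nat.find_spec h').1, fun k hk => ?_, (Nat.find_spec h').2⟩
  by_contra hc
  exact Nat.find_min h' hk ⟨hk.trans (Nat.find_spec h').1, hc⟩

namespace IsVershikMap

variable {φ : B.InfinitePath ≃ₜ B.InfinitePath} (hφ : B.IsVershikMap φ)
include hφ

theorem minUpTo_apply_iff {m : ℕ} {x : B.InfinitePath} : MinUpTo m (φ x) ↔ MaxUpTo m x := by
  constructor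
  · intro h
    by_contra hc
    obtain ⟨n, hn, hlt, hmax⟩ := exists_first_not_isMax hc
    have := (hφ.successor x n hlt hmax).1.1
    exact (h n hn).not_lt this
  · intro h
    by_cases hmax : ∀ n, IsMax (x.1 n)
    · exact fun k _ => hφ.bijOn.mapsTo hmax k
    · have : ¬ ∀ M, MaxUpTo M x := fun hc => hmax fun n => hc (n + 1) n n.lt_succ_self
      push Not at this
      obtain ⟨M, hM⟩ := this
      obtain ⟨n, -, hlt, hn⟩ := exists_first_not_isMax hM
      have hmn : m ≤ n := by
        by_contra hc
        exact hn (h n (by omega))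
      exact fun k hk => (hφ.successor x n hlt hn).2.1 k (by omega)

/-- The successor edge and the minimal path below it depend only on the prefix, so a carry stopping
before level `m` acts on prefixes alone. -/
theorem agree_apply {m : ℕ} {x y : B.InfinitePath} (h : Agree m x y) (hx : ¬ MaxUpTo m x) :
    Agree m (φ x) (φ y) := by
  obtain ⟨n, hn, hlt, hmax⟩ := exists_first_not_isMax hx
  obtain ⟨hx1, hx2, hx3⟩ := hφ.successor x n hlt hmax
  obtain ⟨hy1, hy2, hy3⟩ := hφ.successor y n (fun k hk => h k (by omega) ▸ hlt k hk)
    (h n hn ▸ hmax)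
  have heq : (φ x).1 n = (φ y).1 n := hx1.unique (by rw [h n hn]; exact hy1)
  have hlow : Agree n (φ x) (φ y) := agree_of_minUpTo hx2 hy2 (by unfold vertex; rw [heq])
  intro k hk
  rcases lt_trichotomy k n with hkn | rfl | hkn
  · exact hlow k hkn
  · exact heq
  · rw [hx3 k hkn, hy3 k hkn, h k hk]

/-- Odometer counting: each digit can increase only finitely often. The fixed tail is what lets the
induction on `m` control the edge at level `m`. -/
theorem exists_maxUpTo_iterate (m : ℕ) (x : B.InfinitePath) :
    ∃ i, MaxUpTo m (φ^[i] x) ∧ ∀ k, m ≤ k → (φ^[i] x).1 k = x.1 k := by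
  induction m generalizing x with
  | zero => exact ⟨0, fun k hk => by omega, fun k _ => rfl⟩
  | succ m ih =>
    have := B.finite_E m
    have key : ∀ (e : B.E m) (x : B.InfinitePath), x.1 m = e →
        ∃ i, MaxUpTo (m + 1) (φ^[i] x) ∧ ∀ k, m + 1 ≤ k → (φ^[i] x).1 k = x.1 k := by
      intro e
      induction e using (wellFounded_gt (α := B.E m)).induction with
      | _ e ihe =>
      intro x hx
      obtain ⟨i, hi, htail⟩ := ih x
      by_cases hmax : IsMax (x.1 m)
      · refine ⟨i, fun k hk => ?_, fun k hk => htail k (by omega)⟩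
        rcases Nat.lt_succ_iff_lt_or_eq.1 hk with hk | rfl
        · exact hi k hk
        · rwa [htail k le_rfl]
      · have hs := hφ.successor (φ^[i] x) m hi (by rwa [htail m le_rfl])
        rw [htail m le_rfl, ← Function.iterate_succ_apply' φ] at hs
        obtain ⟨j, hj, hjt⟩ := ihe _ (hx ▸ hs.1.1) (φ^[i + 1] x) rfl
        refine ⟨j + (i + 1), by rwa [Function.iterate_add_apply], fun k hk => ?_⟩
        rw [Function.iterate_add_apply, hjt k hk, hs.2.2 k (by omega), htail k (by omega)]
    exact key _ x rfl

/-- Between an agreement and a disagreement the two orbits are simultaneously at the bottom of a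
tower of level `m`. -/
theorem exists_minUpTo_of_not_agree {m : ℕ} {x y : B.InfinitePath} (h : Agree m x y) {i : ℕ}
    (hi : ¬ Agree m (φ^[i] x) (φ^[i] y)) :
    ∃ j, 0 < j ∧ j ≤ i ∧ MinUpTo m (φ^[j] x) ∧ MinUpTo m (φ^[j] y) := by
  induction i with
  | zero => exact absurd h hi
  | succ i ih =>
    by_cases ha : Agree m (φ^[i] x) (φ^[i] y)
    · have hmax : MaxUpTo m (φ^[i] x) := by
        by_contra hc
        apply hi
        rw [Function.iterate_succ_apply', Function.iterate_succ_apply']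
        exact hφ.agree_apply ha hc
      refine ⟨i + 1, i.succ_pos, le_rfl, ?_, ?_⟩ <;>
        rw [Function.iterate_succ_apply', hφ.minUpTo_apply_iff]
      exacts [hmax, ha.maxUpTo hmax]
    · obtain ⟨j, h0, hj, h1⟩ := ih ha
      exact ⟨j, h0, by omega, h1⟩

/-- Either the orbits still agree when `x` is at a tower top, and the next step takes both to the
bottom, or they have separated, which already required a common bottom. -/
theorem exists_minUpTo_of_agree {m : ℕ} {x y : B.InfinitePath} (h : Agree m x y) :
    ∃ j, 0 < j ∧ MinUpTo m (φ^[j] x) ∧ MinUpTo m (φ^[j] y) := by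
  obtain ⟨i, hi, -⟩ := hφ.exists_maxUpTo_iterate m x
  by_cases ha : Agree m (φ^[i] x) (φ^[i] y)
  · refine ⟨i + 1, i.succ_pos, ?_, ?_⟩ <;>
      rw [Function.iterate_succ_apply', hφ.minUpTo_apply_iff]
    exacts [hi, ha.maxUpTo hi]
  · obtain ⟨j, h0, -, h1⟩ := hφ.exists_minUpTo_of_not_agree h ha
    exact ⟨j, h0, h1⟩

end IsVershikMap

/-! ### Return words and the separating level. -/

/-- `R` is the first positive time at which the orbit of `x` is at the bottom of a tower of
level `m`. -/
def IsReturnTime (φ : B.InfinitePath ≃ₜ B.InfinitePath) (m : ℕ) (x : B.InfinitePath) (R : ℕ) :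
    Prop :=
  IsLeast {j | 0 < j ∧ MinUpTo m (φ^[j] x)} R

namespace IsVershikMap

variable {φ : B.InfinitePath ≃ₜ B.InfinitePath} (hφ : B.IsVershikMap φ)
include hφ

theorem exists_isReturnTime (m : ℕ) (x : B.InfinitePath) : ∃ R, IsReturnTime φ m x R := by
  classical
  obtain ⟨j, h0, hj, -⟩ := hφ.exists_minUpTo_of_agree (m := m) (x := x) (y := x) fun _ _ => rfl
  have h : ∃ j, 0 < j ∧ MinUpTo m (φ^[j] x) := ⟨j, h0, hj⟩
  exact ⟨Nat.find h, Nat.find_spec h, fun k hk => Nat.find_min' h hk⟩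

theorem agree_iterate_of_lt {m : ℕ} {x y : B.InfinitePath} (h : Agree m x y) {R : ℕ}
    (hR : IsReturnTime φ m x R) {i : ℕ} (hi : i < R) : Agree m (φ^[i] x) (φ^[i] y) := by
  by_contra hc
  obtain ⟨j, h0, hj, h1, -⟩ := hφ.exists_minUpTo_of_not_agree h hc
  have := hR.2 ⟨h0, h1⟩
  omega

theorem isReturnTime_of_agree {m : ℕ} {x y : B.InfinitePath} (h : Agree m x y) {R : ℕ}
    (hR : IsReturnTime φ m x R) : IsReturnTime φ m y R := by
  refine ⟨⟨hR.1.1, ?_⟩, fun j hj => ?_⟩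
  · obtain ⟨i, rfl⟩ : ∃ i, R = i + 1 := ⟨R - 1, by have := hR.1.1; omega⟩
    have h1 := hR.1.2
    rw [Function.iterate_succ_apply', hφ.minUpTo_apply_iff] at h1 ⊢
    exact (hφ.agree_iterate_of_lt h hR (by omega)).maxUpTo h1
  · by_contra hc
    exact hc (hR.2 ⟨hj.1, (hφ.agree_iterate_of_lt h hR (by omega)).symm.minUpTo hj.2⟩)

/-- Between two visits to the bottom of towers of level `m`, the itinerary of a point is a product
of words which depend only on the vertices of level `m`. -/
theorem exists_words (m : ℕ) : ∃ (A : Type) (_ : Finite A)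
    (w : A → List (∀ k, Option (B.E k))), Nat.card A ≤ Nat.card (B.V m) ∧ (∀ a, w a ≠ []) ∧
      ∀ (T : ℕ) (x : B.InfinitePath), MinUpTo m x → MinUpTo m (φ^[T] x) →
        ∃ l : List A, (List.range T).map (fun i => code m (φ^[i] x)) = l.flatMap w := by
  have := B.finite_V m
  choose R hR using hφ.exists_isReturnTime m
  -- Only vertices with a minimal path serve as letters; any such path will do, since the vertex
  -- determines the prefix.
  let pick : {a : B.V m // ∃ x : B.InfinitePath, MinUpTo m x ∧ vertex m x = a} → B.InfinitePath :=
    fun a => a.2.choose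
  let w := fun a => (List.range (R (pick a))).map fun i => code m (φ^[i] (pick a))
  refine ⟨{a : B.V m // ∃ x : B.InfinitePath, MinUpTo m x ∧ vertex m x = a}, inferInstance, w,
    Nat.card_le_card_of_injective _ Subtype.val_injective, fun a => ?_, fun T => ?_⟩
  · have := (hR (pick a)).1.1
    simp only [w, ne_eq, List.map_eq_nil_iff, List.range_eq_nil]
    omega
  · induction T using Nat.strong_induction_on with
    | _ T ih =>
    intro x hx hT
    rcases Nat.eq_zero_or_pos T with rfl | hpos
    · exact ⟨[], rfl⟩
    let a : {a : B.V m // ∃ x : B.InfinitePath, MinUpTo m x ∧ vertex m x = a} :=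
      ⟨vertex m x, x, hx, rfl⟩
    have hag : Agree m (pick a) x :=
      agree_of_minUpTo a.2.choose_spec.1 hx a.2.choose_spec.2
    have hret := hφ.isReturnTime_of_agree hag (hR (pick a))
    obtain ⟨T', rfl⟩ : ∃ T', T = R (pick a) + T' := Nat.exists_eq_add_of_le (hret.2 ⟨hpos, hT⟩)
    obtain ⟨l, hl⟩ := ih T' (by have := hret.1.1; omega) (φ^[R (pick a)] x) hret.1.2
      (by rwa [← Function.iterate_add_apply, Nat.add_comm])
    refine ⟨a :: l, ?_⟩
    rw [List.flatMap_cons, ← hl, List.range_add, List.map_append, List.map_map]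
    congr 1
    · refine List.map_congr_left fun i hi => ?_
      exact (code_eq_iff.2 (hφ.agree_iterate_of_lt hag (hR (pick a)) (List.mem_range.1 hi))).symm
    · refine List.map_congr_left fun i _ => ?_
      rw [Function.comp_apply, Nat.add_comm, Function.iterate_add_apply]

/-- If any two orbits agree up to level `m` after a bounded time, then the first `n` edges
separate orbits for some `n`. -/
theorem exists_separating_level
    (hprox : ∀ m, ∃ M : ℕ, ∀ x y : B.InfinitePath, ∃ t ≤ M, Agree m (φ^[t] x) (φ^[t] y))
    (hrank : B.rank < ⊤) :
    ∃ n, ∀ x y : B.InfinitePath, (∀ i : ℤ, Agree n ((φ ^ i) x) ((φ ^ i) y)) → x = y := by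
  by_contra! H
  have hstep : ∀ n, ∃ n', n < n' ∧ ∃ x y : B.InfinitePath,
      (∀ i : ℤ, Agree n ((φ ^ i) x) ((φ ^ i) y)) ∧ ¬ Agree n' x y := by
    intro n
    obtain ⟨x, y, hxy, hne⟩ := H n
    obtain ⟨k, hk⟩ : ∃ k, x.1 k ≠ y.1 k := by
      by_contra! hc
      exact hne (Subtype.ext (funext hc))
    refine ⟨max n k + 1, by omega, x, y, hxy, fun hc => hk (hc k (by omega))⟩
  choose next hnext hpair using hstep
  let N : ℕ → ℕ := fun i => next^[i] 0
  have hN : ∀ i, N (i + 1) = next (N i) := fun i => Function.iterate_succ_apply' next i 0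
  have hmono : StrictMono N := strictMono_nat_of_lt_succ fun i => by rw [hN]; exact hnext _
  obtain ⟨K, hK⟩ : ∃ K : ℕ, ∃ᶠ m in atTop, Nat.card (B.V m) ≤ K := by
    obtain ⟨K, hK⟩ := ENat.ne_top_iff_exists.1 hrank.ne
    refine ⟨K, ?_⟩
    have hlt : B.rank < ((K + 1 : ℕ) : ℕ∞) := by rw [← hK]; exact_mod_cast K.lt_succ_self
    refine (frequently_lt_of_liminf_lt (by isBoundedDefault) hlt).mono fun m hm => ?_
    have : Nat.card (B.V m) < K + 1 := by exact_mod_cast hm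
    omega
  obtain ⟨m, hm, hcard⟩ := (frequently_atTop.1 hK) (N (K + 1))
  obtain ⟨A, hA, w, hAcard, hw, hwords⟩ := hφ.exists_words m
  refine not_forall_relation_of_card_le (q := fun i => truncate (N i))
    (fun i j hij z => truncate_truncate (hmono.monotone hij) z) K (hAcard.trans hcard) hw
    fun i hi => ?_
  have hile : N (i + 1) ≤ m := (hmono.monotone (by omega)).trans hm
  obtain ⟨x, y, hxy, hne⟩ := hpair (N i)
  rw [← hN] at hne
  obtain ⟨M, hM⟩ := hprox m
  -- Starting `M` steps earlier puts an agreement at a time `t ≤ M`, while the disagreement sits at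
  -- time `M`.
  let x₀ := (φ ^ (-(M : ℤ))) x
  let y₀ := (φ ^ (-(M : ℤ))) y
  have hpow : ∀ (j : ℕ) (z : B.InfinitePath), φ^[j] z = (φ ^ (j : ℤ)) z := by
    intro j z
    rw [zpow_natCast]
    induction j with
    | zero => rfl
    | succ j ih => rw [Function.iterate_succ_apply', ih, pow_succ']; rfl
  have hadd : ∀ (a b : ℤ) (z : B.InfinitePath), (φ ^ a) ((φ ^ b) z) = (φ ^ (a + b)) z := by
    intro a b z
    rw [zpow_add]; rfl
  have hback : ∀ z, φ^[M] ((φ ^ (-(M : ℤ))) z) = z := by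
    intro z
    rw [hpow, hadd, add_neg_cancel, zpow_zero]; rfl
  have hcompat : ∀ j : ℕ, Agree (N i) (φ^[j] x₀) (φ^[j] y₀) := by
    intro j
    rw [hpow, hpow, hadd, hadd]
    exact hxy _
  obtain ⟨t, ht, htag⟩ := hM x₀ y₀
  obtain ⟨s, hst, hs, hsx, hsy⟩ : ∃ s, t < s ∧ s ≤ M ∧ MinUpTo m (φ^[s] x₀) ∧
      MinUpTo m (φ^[s] y₀) := by
    obtain ⟨j, h0, hj, h1, h2⟩ := hφ.exists_minUpTo_of_not_agree htag (i := M - t) (by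
      rw [← Function.iterate_add_apply, ← Function.iterate_add_apply, Nat.sub_add_cancel ht,
        hback, hback]
      exact fun hc => hne (hc.mono hile))
    rw [← Function.iterate_add_apply] at h1 h2
    exact ⟨j + t, by omega, by omega, h1, h2⟩
  -- The strict bound `M < u` keeps the disagreement inside the window from `s` to `u`.
  obtain ⟨u, hu, hux, huy⟩ : ∃ u, M < u ∧ MinUpTo m (φ^[u] x₀) ∧ MinUpTo m (φ^[u] y₀) := by
    obtain ⟨t', -, ht'⟩ := hM x y
    obtain ⟨j, h0, h1, h2⟩ := hφ.exists_minUpTo_of_agree ht'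
    refine ⟨j + t' + M, by omega, ?_, ?_⟩
    · rwa [Function.iterate_add_apply, Function.iterate_add_apply, hback]
    · rwa [Function.iterate_add_apply, Function.iterate_add_apply, hback]
  obtain ⟨l₁, hl₁⟩ := hwords (u - s) (φ^[s] x₀) hsx (by
    rwa [← Function.iterate_add_apply, Nat.sub_add_cancel (by omega)])
  obtain ⟨l₂, hl₂⟩ := hwords (u - s) (φ^[s] y₀) hsy (by
    rwa [← Function.iterate_add_apply, Nat.sub_add_cancel (by omega)])
  refine ⟨l₁, l₂, ?_, fun heq => ?_⟩
  · rw [← hl₁, ← hl₂, List.map_map, List.map_map]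
    refine List.map_congr_left fun j _ => ?_
    simp only [Function.comp_apply]
    rw [truncate_code ((hmono.monotone i.le_succ).trans hile),
      truncate_code ((hmono.monotone i.le_succ).trans hile), code_eq_iff,
      ← Function.iterate_add_apply, ← Function.iterate_add_apply]
    exact hcompat _
  · rw [← hl₁, ← hl₂, List.map_map, List.map_map, List.map_inj_left] at heq
    have h1 := heq (M - s) (List.mem_range.2 (by omega))
    simp only [Function.comp_apply] at h1
    rw [truncate_code hile, truncate_code hile, code_eq_iff, ← Function.iterate_add_apply,
      ← Function.iterate_add_apply, Nat.sub_add_cancel hs, hback, hback] at h1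
    exact hne h1

end IsVershikMap

end OrderedBratteliDiagram

/-! ### Compactness, coding and conclusion. -/

/-- In a compact proximal system the times at which two orbits are close occur with bounded gaps,
uniformly over all pairs. -/
theorem IsProximalSystem.exists_uniform_time {X : Type*} [MetricSpace X] [CompactSpace X]
    {f : X ≃ₜ X} (hprox : IsProximalSystem f) {D : Set (X × X)} (hD : IsOpen D)
    (hdiag : ∀ x, (x, x) ∈ D) :
    ∃ M : ℕ, ∀ x y : X, ∃ t ≤ M, (f^[t] x, f^[t] y) ∈ D := by
  have hunif : D ∈ uniformity X := by
    rw [← nhdsSet_diagonal_eq_uniformity, hD.mem_nhdsSet]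
    rintro ⟨x, y⟩ hxy
    obtain rfl : x = y := hxy
    exact hdiag x
  obtain ⟨ε, hε, hsub⟩ := Metric.mem_uniformity_dist.1 hunif
  let U : ℕ → Set (X × X) := fun t => {p | (f^[t] p.1, f^[t] p.2) ∈ D}
  have hU : ∀ t, IsOpen (U t) := fun t =>
    hD.preimage (((f.continuous.iterate t).comp continuous_fst).prodMk
      ((f.continuous.iterate t).comp continuous_snd))
  obtain ⟨s, hs⟩ := isCompact_univ.elim_finite_subcover U hU (by
    rintro ⟨x, y⟩ -
    obtain ⟨t, ht⟩ := (hprox x y ε hε).exists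
    exact Set.mem_iUnion.2 ⟨t, hsub ht⟩)
  refine ⟨s.sup id, fun x y => ?_⟩
  obtain ⟨t, ht, hxy⟩ := Set.mem_iUnion₂.1 (hs (Set.mem_univ (x, y)))
  exact ⟨t, Finset.le_sup (f := id) ht, hxy⟩

/-- A compact system with a continuous finite-valued observable that separates orbits is
symbolic. -/
theorem isSymbolic_of_separating {X : Type*} [TopologicalSpace X] [CompactSpace X] (f : X ≃ₜ X)
    {k : ℕ} {g : X → Fin k} (hg : Continuous g)
    (hsep : ∀ x y, (∀ i : ℤ, g ((f ^ i) x) = g ((f ^ i) y)) → x = y) : IsSymbolic f := by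
  let H : X → ℤ → Fin k := fun x i => g ((f ^ i) x)
  have hcont : Continuous H := continuous_pi fun i => hg.comp (f ^ i).continuous
  have hemb : IsClosedEmbedding H :=
    hcont.isClosedEmbedding fun x y hxy => hsep x y fun i => congrFun hxy i
  have hshift : ∀ (j : ℤ) (x : X),
      H ((f ^ j) x) = SymbolicDynamics.FullShift.shift j (H x) := by
    intro j x
    funext i
    change g ((f ^ i) ((f ^ j) x)) = g ((f ^ (j + i)) x)
    rw [add_comm, zpow_add]
    rfl
  refine ⟨k, ⟨Set.range H, hemb.isClosed_range, ?_⟩, hemb.isEmbedding.toHomeomorph, fun x => ?_⟩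
  · rintro j _ ⟨x, rfl⟩
    exact ⟨(f ^ j) x, hshift j x⟩
  · have := hshift 1 x
    rwa [zpow_one] at this

theorem corollary4p5 {X : Type*} [MetricSpace X] [CompactSpace X]
    (hzero : TopologicalSpace.IsTopologicalBasis {U : Set X | IsClopen U})
    (f : X ≃ₜ X) (hrank : HasFiniteRank f) (hprox : IsProximalSystem f) :
    IsSymbolic f := by
  obtain ⟨_, ⟨B, ⟨φ, hφ, h, hsemi⟩, rfl⟩, hlt⟩ := sInf_lt_iff.1 hrank
  have hedge : ∀ k, Continuous fun x => (h x).1 k := fun k =>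
    (continuous_apply k).comp (continuous_subtype_val.comp h.continuous)
  have hopen : ∀ m, IsOpen {p : X × X | OrderedBratteliDiagram.Agree m (h p.1) (h p.2)} := by
    intro m
    have : {p : X × X | OrderedBratteliDiagram.Agree m (h p.1) (h p.2)} =
        ⋂ k ∈ Set.Iio m, {p : X × X | (h p.1).1 k = (h p.2).1 k} := by
      ext p
      simp [OrderedBratteliDiagram.Agree]
    rw [this]
    refine (Set.finite_Iio m).isOpen_biInter fun k _ => ?_
    exact (isOpen_discrete {q : B.E k × B.E k | q.1 = q.2}).preimage
      (f := fun p : X × X => ((h p.1).1 k, (h p.2).1 k))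
      (((hedge k).comp continuous_fst).prodMk ((hedge k).comp continuous_snd))
  obtain ⟨n, hn⟩ := hφ.exists_separating_level (fun m => by
    obtain ⟨M, hM⟩ := hprox.exists_uniform_time (hopen m) fun x k _ => rfl
    refine ⟨M, fun x y => ?_⟩
    obtain ⟨t, ht, hxy⟩ := hM (h.symm x) (h.symm y)
    refine ⟨t, ht, ?_⟩
    have := hsemi.iterate_right t
    simpa [this.eq] using hxy) hlt
  have hpow : ∀ (i : ℤ) (x : X), h ((f ^ i) x) = (φ ^ i) (h x) := by
    have hnat : ∀ (j : ℕ) (x : X), h ((f ^ j) x) = (φ ^ j) (h x) := by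
      intro j
      induction j with
      | zero => intro x; rfl
      | succ j ih =>
        intro x
        rw [pow_succ, pow_succ]
        exact (ih (f x)).trans (congrArg _ (hsemi x))
    intro i x
    cases i with
    | ofNat j => simpa using hnat j x
    | negSucc j =>
      rw [zpow_negSucc, zpow_negSucc]
      apply (φ ^ (j + 1)).injective
      rw [← hnat]
      exact (congrArg h ((f ^ (j + 1)).apply_symm_apply x)).trans
        ((φ ^ (j + 1)).apply_symm_apply (h x)).symm
  have := B.finite_E
  -- The alphabet is the finite set of `n`-tuples of edges.
  obtain ⟨c, ⟨e⟩⟩ := Finite.exists_equiv_fin (∀ k : Fin n, B.E k)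
  refine isSymbolic_of_separating f (g := fun x => e fun k => (h x).1 k) ?_ fun x y hxy => ?_
  · exact (continuous_of_discreteTopology (f := e)).comp
      (continuous_pi fun k => hedge k)
  · refine h.injective (hn _ _ fun i k hk => ?_)
    rw [← hpow, ← hpow]
    exact congrFun (e.injective (hxy i)) ⟨k, hk⟩
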